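/- Setting. Let $\bar b\ge 0$, $L>0$, $\bar c>0$, and let $\mathcal U_c$ be the set of functions $u:[0,\bar b]\to\mathbb R$ that are nondecreasing, concave and $L$-Lipschitz, with $u(0)=0$ and $u(\bar b)=1$. Fix $u^*\in\mathcal U_c$ and $\sigma^*\ge 1/\bar c$. Let $K\ge 1$ and let $(W_k,Y_k)$, $k=1,\dots,K$, be pairs of random variables with values in $[0,\bar b]$ and finitely supported laws. Let $\varepsilon_{k,1},\varepsilon_{k,2}$ ($k=1,\dots,K$) be i.i.d. with the Gumbel$(0,\sigma^*)$ law, i.e. with density $\frac1{\sigma^*}e^{-x/\sigma^*}e^{-e^{-x/\sigma^*}}$ on $\mathbb R$, and put $Z_k=1$ if $\mathbb E[u^*(W_k)]+\varepsilon_{k,1}\ge\mathbb E[u^*(Y_k)]+\varepsilon_{k,2}$ and $Z_k=-1$ otherwise. Let $0=y_1<\dots<y_N=\bar b$ be the increasing enumeration of $\{0,\bar b\}\cup\bigcup_k\operatorname{supp}(W_k)\cup\bigcup_k\operatorname{supp}(Y_k)$, and let $p^k_j=\mathbb P[W_k=y_j]-\mathbb P[Y_k=y_j]$. Let $P\in\mathbb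 R^{K\times(N-1)}$ be the matrix whose $k$-th row is $(p^k_2,\dots,p^k_N)$, and put $\Sigma_D=\frac1K P^\top P$, $R_D=\operatorname{rank}\Sigma_D$, $\omega=\frac1{2+2e^{2\bar c}}$ and $\alpha^*_j=u^*(y_j)$. Let $(\bar\alpha,\bar\beta,\gamma)$ be an optimal solution of the convex program that maximizes $$-\sum_{k=1}^K\log\Big[1+\exp\Big(\sum_{j=1}^N -Z_kp^k_j\bar\alpha_j\Big)\Big]$$ over $\bar\alpha\in\mathbb R^N$, $\bar\beta\in\mathbb R^{N-1}$, $\gamma\in[0,\bar c]$ subject to $\bar\beta_j=\frac{\bar\alpha_{j+1}-\bar\alpha_j}{y_{j+1}-y_j}$ for $1\le j\le N-1$, $\bar\beta_{j+1}\le\bar\beta_j$ for $1\le j\le N-2$, $\bar\beta_1\le L\gamma$, $\bar\beta_{N-1}\ge0$, $\bar\alpha_1=0$ and $\bar\alpha_N=\gamma$. If $\gamma>0$, put $\hat\alpha=\bar\alpha/\gamma$ and $\hat\sigma=1/\gamma$; if $\gamma=0$, then $\hat\sigma=+\infty$ and $\hat\alpha/\hat\sigma$ is read as $0$. Proposition.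 For every $\lambda>0$ and every $\delta\in(0,1)$, with probability at least $1-\delta$, $$\Big\|\frac{\hat\alpha}{\hat\sigma}-\frac{\alpha^*}{\sigma^*}\Big\|_\infty\le\Big\|\frac{\hat\alpha}{\hat\sigma}-\frac{\alpha^*}{\sigma^*}\Big\|_2\le\frac{\sqrt{\frac{R_D+2\sqrt{-R_D\log\delta}-2\log\delta}{\omega^2K}}+\sqrt{\frac{R_D+2\sqrt{-R_D\log\delta}-2\log\delta}{\omega^2K}+\lambda\big(\bar c\sqrt{N-1}\big)^2}}{\sqrt{\lambda_{\min}(\Sigma_D+\lambda\mathbf I)}},$$ where $\lambda_{\min}$ denotes the smallest eigenvalue. On the event in question, the bounds hold simultaneously for all optimal solutions of the program, and also with $\hat\alpha_j=\hat u(y_j)$ for every pair $(\hat u,\hat\sigma)$ that maximizes the log-likelihood $$\ell(u,\sigma)=\sum_{k=1}^K\log\frac1{1+\exp\big(-Z_k(\mathbb E[u(W_k)]-\mathbb E[u(Y_k)])/\sigma\big)}$$ over $u\in\mathcal U_c$ and $\sigma\ge1/\bar c$. -/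

import Mathlib

open MeasureTheory ProbabilityTheory Matrix

noncomputable section

namespace VNM

/-- The class of admissible utility functions on `[0, b]`: increasing, concave, `L`-Lipschitz
and normalized by `u 0 = 0`, `u b = 1`. (Values of `u` outside `[0, b]` are irrelevant.) -/
structure IsUtility (b L : ℝ) (u : ℝ → ℝ) : Prop where
  monotone : MonotoneOn u (Set.Icc 0 b)
  concave : ConcaveOn ℝ (Set.Icc 0 b) u
  lipschitz : ∀ x ∈ Set.Icc 0 b, ∀ z ∈ Set.Icc 0 b, |u x - u z| ≤ L * |x - z|
  map_zero : u 0 = 0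
  map_right : u b = 1

/-- The Gumbel distribution with location `0` and scale `s`, through its density. -/
def gumbelMeasure (s : ℝ) : Measure ℝ :=
  volume.withDensity fun x =>
    ENNReal.ofReal (1 / s * Real.exp (-(x / s)) * Real.exp (-Real.exp (-(x / s))))

variable {Ω : Type*} [MeasurableSpace Ω]

/-- A lottery: a random variable with values in `[0, b]` whose law is carried by a finite set. -/
structure IsLottery (μ : Measure Ω) (b : ℝ) (X : Ω → ℝ) : Prop where
  measurable : Measurable X
  mem_Icc : ∀ w, X w ∈ Set.Icc 0 b
  finite_support : ∃ F : Finset ℝ, ∀ᵐ w ∂μ, X w ∈ F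

/-- The support of a discretely distributed random variable: the values with positive mass. -/
def lotterySupport (μ : Measure Ω) (X : Ω → ℝ) : Set ℝ :=
  {x | 0 < μ {w | X w = x}}

/-- The set of breakpoints: `0`, `b`, and all payoffs of all lotteries in the dataset. -/
def breakpoints {K : ℕ} (μ : Measure Ω) (b : ℝ) (W Y : Fin K → Ω → ℝ) : Set ℝ :=
  {0} ∪ (⋃ k, lotterySupport μ (W k)) ∪ (⋃ k, lotterySupport μ (Y k)) ∪ {b}

/-- The answers of the decision maker: `Z k = 1` if the random utility
`E[u (W k)] + ε k 0` is at least the random utility `E[u (Y k)] + ε k 1`, and `-1` otherwise. -/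
def choice {K : ℕ} (μ : Measure Ω) (u : ℝ → ℝ) (W Y : Fin K → Ω → ℝ)
    (ε : Fin K → Fin 2 → Ω → ℝ) (w : Ω) (k : Fin K) : ℝ :=
  open Classical in
  if (∫ v, u (Y k v) ∂μ) + ε k 1 w ≤ (∫ v, u (W k v) ∂μ) + ε k 0 w then 1 else -1

/-- The log-likelihood of a utility function `u` and a scale `s`, given the answers `Z`. -/
def logLik {K : ℕ} (μ : Measure Ω) (W Y : Fin K → Ω → ℝ) (Z : Fin K → ℝ)
    (u : ℝ → ℝ) (s : ℝ) : ℝ :=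
  ∑ k, Real.log
    (1 / (1 + Real.exp (-Z k * ((∫ v, u (W k v) ∂μ) - ∫ v, u (Y k v) ∂μ) / s)))

/-- `(u, s)` maximizes the log-likelihood over the admissible utilities and `s ≥ 1 / c`. -/
def IsMLE {K : ℕ} (μ : Measure Ω) (b L c : ℝ) (W Y : Fin K → Ω → ℝ) (Z : Fin K → ℝ)
    (u : ℝ → ℝ) (s : ℝ) : Prop :=
  (IsUtility b L u ∧ 1 / c ≤ s) ∧
    ∀ u' s', IsUtility b L u' → 1 / c ≤ s' → logLik μ W Y Z u' s' ≤ logLik μ W Y Z u s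

/-- The probability-mass differences `p k j = P[W k = y j] - P[Y k = y j]`. -/
def massDiff {K n : ℕ} (μ : Measure Ω) (y : Fin (n + 1) → ℝ) (W Y : Fin K → Ω → ℝ)
    (k : Fin K) (j : Fin (n + 1)) : ℝ :=
  μ.real {w | W k w = y j} - μ.real {w | Y k w = y j}

/-- The reduced matrix `P`: the rows are the vectors `p k` without their first entry. -/
def massDiffMatrix {K n : ℕ} (μ : Measure Ω) (y : Fin (n + 1) → ℝ) (W Y : Fin K → Ω → ℝ) :
    Matrix (Fin K) (Fin n) ℝ :=
  Matrix.of fun k j => massDiff μ y W Y k j.succ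

/-- The empirical information matrix `(1 / K) Pᵀ P`. -/
def infoMatrix {K n : ℕ} (μ : Measure Ω) (y : Fin (n + 1) → ℝ) (W Y : Fin K → Ω → ℝ) :
    Matrix (Fin n) (Fin n) ℝ :=
  (1 / (K : ℝ)) • ((massDiffMatrix μ y W Y)ᵀ * massDiffMatrix μ y W Y)

/-- The constraints of the convex program for `(a, β, γ)`, over breakpoints
`y 0 < ... < y n`. -/
structure IsFeasible {n : ℕ} (L c : ℝ) (y : Fin (n + 1) → ℝ)
    (a : Fin (n + 1) → ℝ) (β : Fin n → ℝ) (γ : ℝ) : Prop where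
  slope : ∀ j : Fin n, β j = (a j.succ - a j.castSucc) / (y j.succ - y j.castSucc)
  slope_anti : ∀ i j : Fin n, j.val = i.val + 1 → β j ≤ β i
  slope_first : ∀ j : Fin n, j.val = 0 → β j ≤ L * γ
  slope_last : ∀ j : Fin n, j.val + 1 = n → 0 ≤ β j
  left : a 0 = 0
  right : a (Fin.last n) = γ
  scale : γ ∈ Set.Icc 0 c

/-- The objective of the convex program. -/
def objective {K n : ℕ} (p : Fin K → Fin (n + 1) → ℝ) (Z : Fin K → ℝ)
    (a : Fin (n + 1) → ℝ) : ℝ :=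
  -∑ k, Real.log (1 + Real.exp (∑ j, -Z k * p k j * a j))

/-- `(a, β, γ)` is an optimal solution of the convex program. -/
def IsOptimal {K n : ℕ} (L c : ℝ) (y : Fin (n + 1) → ℝ) (p : Fin K → Fin (n + 1) → ℝ)
    (Z : Fin K → ℝ) (a : Fin (n + 1) → ℝ) (β : Fin n → ℝ) (γ : ℝ) : Prop :=
  IsFeasible L c y a β γ ∧
    ∀ a' β' γ', IsFeasible L c y a' β' γ' → objective p Z a' ≤ objective p Z a

/-- The quotient `α̂ / σ̂` obtained from an optimal solution of the convex program:
if `γ > 0`, then `α̂ = a / γ` and `σ̂ = 1 / γ`; if `γ = 0`, then `σ̂ = +∞` and the quotient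
is `0`. -/
def scaledEstimate {n : ℕ} (a : Fin (n + 1) → ℝ) (γ : ℝ) : Fin (n + 1) → ℝ :=
  open Classical in
  if 0 < γ then fun j => (a j / γ) / (1 / γ) else 0

/-- The smallest eigenvalue of a real symmetric matrix of positive size. -/
def minEigenvalue {n : ℕ} (A : Matrix (Fin n) (Fin n) ℝ) : ℝ :=
  sInf (spectrum ℝ A)

/-- The quantity `(R + 2 √(-R log δ) - 2 log δ) / (ω² K)`, where `R` is the rank of the
information matrix `S` and `ω = 1 / (2 + 2 exp (2 c))`. -/
def deviation {n : ℕ} (K : ℕ) (c δ : ℝ) (S : Matrix (Fin n) (Fin n) ℝ) : ℝ :=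
  ((S.rank : ℝ) + 2 * Real.sqrt (-(S.rank : ℝ) * Real.log δ) - 2 * Real.log δ) /
    ((1 / (2 + 2 * Real.exp (2 * c))) ^ 2 * K)

/-- The error bound; here `n = N - 1`, where `N` is the number of breakpoints. -/
def errorBound {n : ℕ} (K : ℕ) (c r δ : ℝ) (S : Matrix (Fin n) (Fin n) ℝ) : ℝ :=
  (Real.sqrt (deviation K c δ S) +
      Real.sqrt (deviation K c δ S + r * (c * Real.sqrt n) ^ 2)) /
    Real.sqrt (minEigenvalue (S + r • (1 : Matrix (Fin n) (Fin n) ℝ)))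

/-- The `ℓ_∞` distance of `θ` and `θ'` is at most their `ℓ_2` distance, which is at most `B`. -/
def ErrorsLE {m : ℕ} (θ θ' : Fin m → ℝ) (B : ℝ) : Prop :=
  ‖θ - θ'‖ ≤ ‖WithLp.toLp 2 (θ - θ')‖ ∧ ‖WithLp.toLp 2 (θ - θ')‖ ≤ B

end VNM

end

/-! The true parameter `θ = α*/σ*` is feasible for the convex program, and the bound holds for every
feasible `a` whose objective is at least that of `θ`. Feasible points have entries in `[0, c]`, so
each mean difference `⟨p k, a⟩` lies in `[-c, c]`, where the logistic loss is strongly convex with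
modulus `ω` (`log_one_add_exp_neg_ge`). Let `x = a - θ` without its vanishing first entry. Expanding
the loss at `θ` gives `ω/2 ‖P x‖² ≤ ⟨V, P x⟩`, where `V` is the vector of residuals. Only the
projection `ΠV` onto the range of `P` matters (`exists_orthonormal_rank`), so `‖P x‖ ≤ (2/ω) ‖ΠV‖`.
Adding the ridge term `λ ‖x‖²` and dividing by the least eigenvalue bounds `x`
(`norm_le_errorBound`).

The difference of two Gumbel variables is logistic, so the residuals are centred; they are also
independent and confined to intervals of length one, hence `1/4`-sub-Gaussian. Gaussian
linearization of the square gives `E exp ‖ΠV‖² ≤ 2^(R/2)`, and Markov's inequality yields `‖ΠV‖² ≤ R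
- log δ` with probability at least `1 - δ`, which is sharper than needed. This event involves `V`
alone, so the bounds hold for all estimates simultaneously. -/

namespace VNM

/-! ### Exponential moments of projected sub-Gaussian vectors. -/

section Probability

open Filter Topology

/-- The `k`-th residual depends on the pair `ε k 0, ε k 1`, so independence is needed between pairs.
Currying carries a product measure to a product of product measures. -/
lemma iIndepFun_curry {Ω ι κ : Type*} [MeasurableSpace Ω] {μ : Measure Ω}
    {X : ι → κ → Ω → ℝ} (hX : ∀ i j, Measurable (X i j))
    (h : iIndepFun (fun p : ι × κ => X p.1 p.2) μ) :
    iIndepFun (fun i ω j => X i j ω) μ := by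
  have := h.isProbabilityMeasure
  have h' : iIndepFun (fun p : (_ : ι) × κ => X p.1 p.2) μ :=
    h.precomp (Equiv.sigmaEquivProd ι κ).injective
  have hi : ∀ i, iIndepFun (X i) μ := fun i =>
    iIndepFun.precomp (f := fun p : ι × κ => X p.1 p.2) (g := Prod.mk i)
      (Prod.mk_right_injective i) h
  have : ∀ i j, IsProbabilityMeasure (μ.map (X i j)) :=
    fun i j => Measure.isProbabilityMeasure_map (hX i j).aemeasurable
  have hc : (MeasurableEquiv.piCurry fun (_ : ι) (_ : κ) => ℝ) ∘
      (fun ω (p : (_ : ι) × κ) => X p.1 p.2 ω) = fun ω i j => X i j ω := by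
    ext; simp [Sigma.curry]
  rw [iIndepFun_iff_map_fun_eq_infinitePi_map (by fun_prop), ← hc,
    ← Measure.map_map (by fun_prop) (by fun_prop),
    (iIndepFun_iff_map_fun_eq_infinitePi_map (by fun_prop)).1 h',
    Measure.infinitePi_map_piCurry (fun i j => μ.map (X i j))]
  congrm Measure.infinitePi fun i => ?_
  rw [(iIndepFun_iff_map_fun_eq_infinitePi_map (by fun_prop)).1 (hi i)]

lemma integrable_exp_sq_div_four_gaussianReal :
    Integrable (fun x : ℝ => Real.exp (x ^ 2 / 4)) (gaussianReal 0 1) := by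
  rw [gaussianReal_of_var_ne_zero _ one_ne_zero,
    integrable_withDensity_iff_integrable_smul' (by fun_prop) (by simp [gaussianPDF])]
  have h := (integrable_exp_neg_mul_sq (b := 1 / 4) (by norm_num)).const_mul (√(2 * Real.pi * 1))⁻¹
  refine h.congr (ae_of_all _ fun x => ?_)
  simp only [toReal_gaussianPDF, gaussianPDFReal, smul_eq_mul, mul_assoc, ← Real.exp_add,
    NNReal.coe_one]
  ring_nf

lemma integral_exp_sq_div_four_gaussianReal :
    ∫ x : ℝ, Real.exp (x ^ 2 / 4) ∂gaussianReal 0 1 = √2 := by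
  rw [integral_gaussianReal_eq_integral_smul one_ne_zero]
  have h : ∀ x : ℝ, gaussianPDFReal 0 1 x • Real.exp (x ^ 2 / 4) =
      (√(2 * Real.pi))⁻¹ * Real.exp (-(1 / 4) * x ^ 2) := fun x => by
    simp only [gaussianPDFReal, smul_eq_mul, mul_assoc, ← Real.exp_add, NNReal.coe_one]
    ring_nf
  simp_rw [h]
  rw [integral_const_mul, integral_gaussian, ← Real.sqrt_inv, ← Real.sqrt_mul (by positivity)]
  congr 1
  field_simp
  norm_num

lemma integral_exp_sqrt_two_mul_gaussianReal (a : ℝ) :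
    ∫ x : ℝ, Real.exp (√2 * a * x) ∂gaussianReal 0 1 = Real.exp (a ^ 2) := by
  have := congrFun (mgf_fun_id_gaussianReal (μ := 0) (v := 1)) (√2 * a)
  simp only [mgf] at this
  rw [this, mul_pow, Real.sq_sqrt zero_le_two]
  simp

/-- The squared length of the projection of a vector with independent `1/4`-sub-Gaussian entries
onto the span of `m` orthonormal vectors has an exponential moment at most `2 ^ (m / 2)`. -/
lemma lintegral_exp_sum_sq_le {Ω : Type*} [MeasurableSpace Ω] {μ : Measure Ω}
    [IsProbabilityMeasure μ] {K m : ℕ} {V : Fin K → Ω → ℝ} (hV : ∀ k, Measurable (V k))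
    (hind : iIndepFun V μ) (hsub : ∀ k, HasSubgaussianMGF (V k) (1 / 4) μ)
    {e : Fin m → EuclideanSpace ℝ (Fin K)} (he : Orthonormal ℝ e) :
    ∫⁻ ω, ENNReal.ofReal (Real.exp (∑ i, (∑ k, e i k * V k ω) ^ 2)) ∂μ
      ≤ ENNReal.ofReal (√2 ^ m) := by
  set γ : Measure (Fin m → ℝ) := Measure.pi fun _ => gaussianReal 0 1 with hγ
  -- Linearization: `exp (a²)` is the mean of `exp (√2 a x)` for a standard Gaussian `x`.
  have h1 : ∀ ω, ENNReal.ofReal (Real.exp (∑ i, (∑ k, e i k * V k ω) ^ 2)) =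
      ∫⁻ x, ENNReal.ofReal (∏ i, Real.exp (√2 * (∑ k, e i k * V k ω) * x i)) ∂γ := fun ω => by
    rw [← ofReal_integral_eq_lintegral_ofReal, hγ,
      integral_fintype_prod_eq_prod (fun i x => Real.exp (√2 * (∑ k, e i k * V k ω) * x))]
    · simp_rw [integral_exp_sqrt_two_mul_gaussianReal, Real.exp_sum]
    · exact Integrable.fintype_prod (f := fun i x => Real.exp (√2 * (∑ k, e i k * V k ω) * x))
        fun i => integrable_exp_mul_gaussianReal _
    · exact ae_of_all _ fun x => by positivity
  have hnorm : ∀ x : Fin m → ℝ, ∑ k, (∑ i, x i * e i k) ^ 2 = ∑ i, x i ^ 2 := fun x => by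
    have h := he.inner_sum x x Finset.univ
    have h2 : ∀ v : EuclideanSpace ℝ (Fin K), inner ℝ v v = ∑ k, v k ^ 2 := fun v => by
      rw [real_inner_self_eq_norm_sq, EuclideanSpace.norm_sq_eq]; simp
    rw [h2] at h
    simpa [pow_two] using h
  -- For fixed `x` the exponent is linear in `V`, and orthonormality turns its variance factor into
  -- `‖x‖² / 4`.
  have h3 : ∀ x : Fin m → ℝ,
      ∫⁻ ω, ENNReal.ofReal (∏ i, Real.exp (√2 * (∑ k, e i k * V k ω) * x i)) ∂μ ≤
        ENNReal.ofReal (∏ i, Real.exp (x i ^ 2 / 4)) := fun x => by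
    have hs := HasSubgaussianMGF.sum_of_iIndepFun
      (hind.comp (fun k v => (∑ i, x i * e i k) * v) fun k => by fun_prop)
      (s := Finset.univ) fun k _ => (hsub k).const_mul (∑ i, x i * e i k)
    have hprod : ∀ ω, ∏ i, Real.exp (√2 * (∑ k, e i k * V k ω) * x i) =
        Real.exp (√2 * ∑ k, ((fun v => (∑ i, x i * e i k) * v) ∘ V k) ω) := fun ω => by
      rw [← Real.exp_sum]
      congr 1
      simp only [Function.comp, Finset.mul_sum, Finset.sum_mul]
      rw [Finset.sum_comm]
      exact Finset.sum_congr rfl fun _ _ => Finset.sum_congr rfl fun _ _ => by ring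
    simp_rw [hprod]
    rw [← ofReal_integral_eq_lintegral_ofReal (hs.integrable_exp_mul _)
      (ae_of_all _ fun _ => by positivity)]
    refine ENNReal.ofReal_le_ofReal ((hs.mgf_le √2).trans ?_)
    rw [← Real.exp_sum]
    refine Real.exp_le_exp.2 (le_of_eq ?_)
    rw [Real.sq_sqrt zero_le_two, ← Finset.sum_div, ← hnorm]
    have hcoe : ∀ a : ℝ, ((NNReal.mk (a ^ 2) (sq_nonneg a) * (1 / 4) : NNReal) : ℝ) =
        a ^ 2 / 4 := fun a => by
      rw [NNReal.coe_mul, NNReal.coe_mk]; norm_num; ring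
    have hsum := (NNReal.coe_sum (s := Finset.univ) (f := fun k =>
      NNReal.mk ((∑ i, x i * e i k) ^ 2) (sq_nonneg _) * (1 / 4))).trans
      (Finset.sum_congr rfl fun k _ => hcoe _)
    rw [← Finset.sum_div] at hsum
    erw [hsum]
    ring
  simp_rw [h1]
  rw [lintegral_lintegral_swap]
  · refine (lintegral_mono h3).trans (le_of_eq ?_)
    rw [← ofReal_integral_eq_lintegral_ofReal, hγ,
      integral_fintype_prod_eq_prod (fun _ x => Real.exp (x ^ 2 / 4))]
    · simp [integral_exp_sq_div_four_gaussianReal]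
    · exact Integrable.fintype_prod (f := fun _ x => Real.exp (x ^ 2 / 4))
        fun i => integrable_exp_sq_div_four_gaussianReal
    · exact ae_of_all _ fun x => by positivity
  · refine Measurable.aemeasurable ?_
    unfold Function.uncurry
    fun_prop

/-- A tail bound for the squared length of the projection. -/
lemma one_sub_le_measureReal_sum_sq_le {Ω : Type*} [MeasurableSpace Ω] {μ : Measure Ω}
    [IsProbabilityMeasure μ] {K m : ℕ} {V : Fin K → Ω → ℝ} (hV : ∀ k, Measurable (V k))
    (hind : iIndepFun V μ) (hsub : ∀ k, HasSubgaussianMGF (V k) (1 / 4) μ)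
    {e : Fin m → EuclideanSpace ℝ (Fin K)} (he : Orthonormal ℝ e) {δ : ℝ} (hδ : 0 < δ) :
    1 - δ ≤ μ.real {ω | ∑ i, (∑ k, e i k * V k ω) ^ 2 ≤ m - Real.log δ} := by
  have hmeas : Measurable fun ω => ∑ i, (∑ k, e i k * V k ω) ^ 2 := by fun_prop
  have hset : MeasurableSet {ω | ∑ i, (∑ k, e i k * V k ω) ^ 2 ≤ m - Real.log δ} :=
    measurableSet_le hmeas measurable_const
  have hM := mul_meas_ge_le_lintegral₀ (μ := μ) (f := fun ω =>
    ENNReal.ofReal (Real.exp (∑ i, (∑ k, e i k * V k ω) ^ 2))) (by fun_prop)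
    (ENNReal.ofReal (Real.exp (m - Real.log δ)))
  have hM2 := hM.trans (lintegral_exp_sum_sq_le hV hind hsub he)
  -- This matches the threshold `m - log δ`, whose exponential is `exp m / δ`.
  have hsq : √2 ^ m ≤ Real.exp m := by
    rw [← mul_one (m : ℝ), Real.exp_nat_mul]
    refine pow_le_pow_left₀ (by positivity) ?_ m
    rw [Real.sqrt_le_left (by positivity)]
    nlinarith [Real.add_one_le_exp (1 : ℝ)]
  have hc : μ.real {ω | ∑ i, (∑ k, e i k * V k ω) ^ 2 ≤ m - Real.log δ}ᶜ ≤ δ := by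
    have hsubs : {ω | ∑ i, (∑ k, e i k * V k ω) ^ 2 ≤ m - Real.log δ}ᶜ ⊆
        {ω | ENNReal.ofReal (Real.exp (m - Real.log δ)) ≤
          ENNReal.ofReal (Real.exp (∑ i, (∑ k, e i k * V k ω) ^ 2))} := fun ω hω => by
      simp only [Set.mem_compl_iff, Set.mem_ofPred_eq, not_le] at hω
      exact ENNReal.ofReal_le_ofReal (Real.exp_le_exp.2 hω.le)
    have h4 := (mul_le_mul_right (measure_mono hsubs)
      (ENNReal.ofReal (Real.exp (m - Real.log δ)))).trans hM2
    have h5 := ENNReal.toReal_mono ENNReal.ofReal_ne_top h4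
    rw [ENNReal.toReal_mul, ENNReal.toReal_ofReal (by positivity),
      ENNReal.toReal_ofReal (by positivity)] at h5
    rw [Real.exp_sub, Real.exp_log hδ] at h5
    rw [Measure.real]
    have h6 := h5.trans hsq
    rw [div_mul_eq_mul_div, div_le_iff₀ hδ] at h6
    exact le_of_mul_le_mul_left h6 (Real.exp_pos _)
  rw [probReal_compl_eq_one_sub hset] at hc
  linarith

/-! ### The Gumbel law and its logistic differences. -/

/-- The case `q = 1` gives the Gumbel distribution function; `q = 1 + exp (-(d / s))` arises when
that function, shifted by `d`, is integrated against the density. -/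
lemma hasDerivAt_exp_neg_mul_exp {s : ℝ} (q x : ℝ) :
    HasDerivAt (fun x => Real.exp (-(q * Real.exp (-(x / s)))))
      (q * (1 / s * Real.exp (-(x / s)) * Real.exp (-(q * Real.exp (-(x / s)))))) x := by
  have h := ((((hasDerivAt_id x).div_const s).neg.exp.const_mul q).neg).exp
  refine h.congr_deriv ?_
  simp only [id, Pi.neg_apply]
  ring

lemma tendsto_exp_neg_mul_exp_atBot {s q : ℝ} (hs : 0 < s) (hq : 0 < q) :
    Tendsto (fun x => Real.exp (-(q * Real.exp (-(x / s))))) atBot (𝓝 0) := by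
  refine Real.tendsto_exp_atBot.comp (tendsto_neg_atTop_atBot.comp ?_)
  refine Tendsto.const_mul_atTop hq (Real.tendsto_exp_atTop.comp ?_)
  exact tendsto_neg_atBot_atTop.comp (tendsto_id.atBot_div_const hs)

lemma tendsto_exp_neg_mul_exp_atTop {s : ℝ} (hs : 0 < s) (q : ℝ) :
    Tendsto (fun x => Real.exp (-(q * Real.exp (-(x / s))))) atTop (𝓝 1) := by
  have h : Tendsto (fun x => Real.exp (-(x / s))) atTop (𝓝 0) :=
    Real.tendsto_exp_atBot.comp (tendsto_neg_atTop_atBot.comp (tendsto_id.atTop_div_const hs))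
  simpa using ((h.const_mul q).neg).rexp

lemma integrable_exp_neg_mul_exp {s q : ℝ} (hs : 0 < s) (hq : 0 < q) :
    Integrable fun x =>
      q * (1 / s * Real.exp (-(x / s)) * Real.exp (-(q * Real.exp (-(x / s))))) := by
  rw [← integrableOn_univ, ← Set.Iic_union_Ioi (a := (0 : ℝ)), integrableOn_union]
  refine ⟨?_, integrableOn_Ioi_deriv_of_nonneg' (fun x _ => hasDerivAt_exp_neg_mul_exp q x)
    (fun x _ => by positivity) (tendsto_exp_neg_mul_exp_atTop hs q)⟩
  -- The left half-line is reflected onto the right one, where a derivative of constant sign is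
  -- integrable because its primitive has a limit.
  have hd : ∀ x : ℝ, HasDerivAt (fun x => Real.exp (-(q * Real.exp (-(-x / s)))))
      (-(q * (1 / s * Real.exp (-(-x / s)) * Real.exp (-(q * Real.exp (-(-x / s))))))) x := by
    intro x
    have h := (hasDerivAt_exp_neg_mul_exp (s := s) q (-x)).comp x (hasDerivAt_neg x)
    exact h.congr_deriv (by ring)
  have h := integrableOn_Ioi_deriv_of_nonpos' (a := (0 : ℝ)) (fun x _ => hd x)
    (fun x _ => neg_nonpos.2 (by positivity))
    ((tendsto_exp_neg_mul_exp_atBot hs hq).comp tendsto_neg_atTop_atBot)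
  rw [← neg_zero] at h
  rw [integrableOn_Iic_iff_integrableOn_Iio]
  simpa using h.neg.comp_neg_Iio

lemma gumbelMeasure_Iic {s : ℝ} (hs : 0 < s) (x : ℝ) :
    gumbelMeasure s (Set.Iic x) = ENNReal.ofReal (Real.exp (-Real.exp (-(x / s)))) := by
  have hi := integrable_exp_neg_mul_exp hs one_pos
  have h := integral_Iic_of_hasDerivAt_of_tendsto' (a := x)
    (fun x _ => hasDerivAt_exp_neg_mul_exp (s := s) 1 x) hi.integrableOn
    (tendsto_exp_neg_mul_exp_atBot hs one_pos)
  simp only [one_mul, sub_zero] at h hi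
  rw [gumbelMeasure, withDensity_apply _ measurableSet_Iic, ← h,
    ofReal_integral_eq_lintegral_ofReal hi.integrableOn (ae_of_all _ fun x => by positivity)]

lemma measurable_gumbelDensity (s : ℝ) : Measurable fun x : ℝ =>
    ENNReal.ofReal (1 / s * Real.exp (-(x / s)) * Real.exp (-Real.exp (-(x / s)))) := by
  fun_prop

/-- The difference of independent Gumbel variables has the logistic law. -/
lemma gumbelMeasure_prod_le {s : ℝ} (hs : 0 < s) [SFinite (gumbelMeasure s)] (d : ℝ) :
    ((gumbelMeasure s).prod (gumbelMeasure s)) {p | p.2 ≤ p.1 + d} =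
      ENNReal.ofReal (1 / (1 + Real.exp (-(d / s)))) := by
  rw [Measure.prod_apply (measurableSet_le (by fun_prop) (by fun_prop))]
  have h1 : ∀ x : ℝ, gumbelMeasure s (Prod.mk x ⁻¹' {p : ℝ × ℝ | p.2 ≤ p.1 + d}) =
      ENNReal.ofReal (Real.exp (-Real.exp (-((x + d) / s)))) := fun x => by
    rw [← gumbelMeasure_Iic hs]; rfl
  simp_rw [h1]
  set q := 1 + Real.exp (-(d / s)) with hq
  have hq0 : 0 < q := by positivity
  have hi := integrable_exp_neg_mul_exp hs hq0
  have h := integral_of_hasDerivAt_of_tendsto (fun x => hasDerivAt_exp_neg_mul_exp (s := s) q x) hi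
    (tendsto_exp_neg_mul_exp_atBot hs hq0) (tendsto_exp_neg_mul_exp_atTop hs q)
  rw [gumbelMeasure, lintegral_withDensity_eq_lintegral_mul _ (measurable_gumbelDensity s)
    (by fun_prop)]
  -- The two double exponentials merge into one with parameter `q`, leaving `1 / q` times an exact
  -- derivative of total integral `1`.
  have h2 : ∀ x, ((fun x : ℝ => ENNReal.ofReal
        (1 / s * Real.exp (-(x / s)) * Real.exp (-Real.exp (-(x / s))))) *
      fun x => ENNReal.ofReal (Real.exp (-Real.exp (-((x + d) / s))))) x =
      ENNReal.ofReal (1 / q * (q * (1 / s * Real.exp (-(x / s)) *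
        Real.exp (-(q * Real.exp (-(x / s))))))) := fun x => by
    rw [Pi.mul_apply, ← ENNReal.ofReal_mul (by positivity), mul_assoc, ← Real.exp_add]
    congr 1
    have : -Real.exp (-(x / s)) + -Real.exp (-((x + d) / s)) = -(q * Real.exp (-(x / s))) := by
      rw [hq, add_mul, ← Real.exp_add, add_div]
      ring_nf
    rw [this]
    field_simp
  simp_rw [h2]
  rw [← ofReal_integral_eq_lintegral_ofReal (hi.const_mul _) (ae_of_all _ fun x => by positivity),
    integral_const_mul, h]
  simp

end Probability

/-! ### Strong convexity of the logistic loss. -/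

lemma hasDerivAt_log_one_add_exp_neg (x : ℝ) :
    HasDerivAt (fun x => Real.log (1 + Real.exp (-x))) (-(1 / (1 + Real.exp x))) x := by
  have h := ((hasDerivAt_neg x).exp.const_add 1).log (by positivity)
  refine h.congr_deriv ?_
  rw [Real.exp_neg]
  field_simp
  ring

lemma hasDerivAt_neg_inv_one_add_exp (x : ℝ) :
    HasDerivAt (fun x => -(1 / (1 + Real.exp x))) (Real.exp x / (1 + Real.exp x) ^ 2) x := by
  have h := ((((Real.hasDerivAt_exp x).const_add 1).inv (by positivity))).neg
  simp only [one_div]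
  exact h.congr_deriv (by ring)

lemma le_exp_div_one_add_exp_sq {c x : ℝ} (hx : x ∈ Set.Icc (-c) c) :
    1 / (2 + 2 * Real.exp (2 * c)) ≤ Real.exp x / (1 + Real.exp x) ^ 2 := by
  rw [div_le_div_iff₀ (by positivity) (by positivity)]
  have h1 : 1 ≤ Real.exp (2 * c) * Real.exp x := by
    rw [← Real.exp_add]
    exact Real.one_le_exp (by linarith [hx.1, hx.2])
  have h2 : Real.exp x * Real.exp x ≤ Real.exp (2 * c) * Real.exp x := by
    rw [← Real.exp_add, ← Real.exp_add]
    exact Real.exp_le_exp.2 (by linarith [hx.1, hx.2])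
  nlinarith

lemma convexOn_log_one_add_exp_neg_sub_sq (c : ℝ) :
    ConvexOn ℝ (Set.Icc (-c) c) fun x =>
      Real.log (1 + Real.exp (-x)) - 1 / (2 + 2 * Real.exp (2 * c)) / 2 * x ^ 2 := by
  have hd : ∀ x, HasDerivAt (fun x =>
      Real.log (1 + Real.exp (-x)) - 1 / (2 + 2 * Real.exp (2 * c)) / 2 * x ^ 2)
      (-(1 / (1 + Real.exp x)) - 1 / (2 + 2 * Real.exp (2 * c)) * x) x := fun x =>
    ((hasDerivAt_log_one_add_exp_neg x).sub ((hasDerivAt_pow 2 x).const_mul _)).congr_deriv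
      (by push_cast; ring)
  have hd2 : ∀ x, HasDerivAt (fun x =>
      -(1 / (1 + Real.exp x)) - 1 / (2 + 2 * Real.exp (2 * c)) * x)
      (Real.exp x / (1 + Real.exp x) ^ 2 - 1 / (2 + 2 * Real.exp (2 * c))) x := fun x =>
    ((hasDerivAt_neg_inv_one_add_exp x).sub ((hasDerivAt_id x).const_mul _)).congr_deriv
      (by ring)
  refine MonotoneOn.convexOn_of_deriv (convex_Icc _ _)
    (fun x _ => (hd x).continuousAt.continuousWithinAt)
    (fun x _ => (hd x).differentiableAt.differentiableWithinAt) ?_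
  rw [funext fun x => (hd x).deriv]
  refine monotoneOn_of_deriv_nonneg (convex_Icc _ _).interior
    (fun x _ => (hd2 x).continuousAt.continuousWithinAt)
    (fun x _ => (hd2 x).differentiableAt.differentiableWithinAt) fun x hx => ?_
  rw [(hd2 x).deriv]
  exact sub_nonneg.2 (le_exp_div_one_add_exp_sq (interior_subset (interior_subset hx)))

/-- Strong convexity of the logistic loss on `[-c, c]`. -/
lemma log_one_add_exp_neg_ge {c t u : ℝ} (ht : t ∈ Set.Icc (-c) c) (hu : u ∈ Set.Icc (-c) c) :
    Real.log (1 + Real.exp (-t)) - 1 / (1 + Real.exp t) * (u - t) +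
        1 / (2 + 2 * Real.exp (2 * c)) / 2 * (u - t) ^ 2 ≤
      Real.log (1 + Real.exp (-u)) := by
  have hconv := convexOn_log_one_add_exp_neg_sub_sq c
  have hd : HasDerivAt (fun x =>
      Real.log (1 + Real.exp (-x)) - 1 / (2 + 2 * Real.exp (2 * c)) / 2 * x ^ 2)
      (-(1 / (1 + Real.exp t)) - 1 / (2 + 2 * Real.exp (2 * c)) * t) t :=
    ((hasDerivAt_log_one_add_exp_neg t).sub ((hasDerivAt_pow 2 t).const_mul _)).congr_deriv
      (by push_cast; ring)
  -- The loss minus `ω/2 x²` is convex, hence lies above its tangent at `t`.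
  rcases lt_trichotomy t u with h | rfl | h
  · have := hconv.le_slope_of_hasDerivAt ht hu h hd
    rw [slope_def_field, le_div_iff₀ (sub_pos.2 h)] at this
    linarith
  · simp
  · have := hconv.slope_le_of_hasDerivAt hu ht h hd
    rw [slope_def_field, div_le_iff₀ (sub_pos.2 h)] at this
    linarith

/-! ### Least eigenvalues, the range of `P`, and the deterministic bound. -/

lemma minEigenvalue_mul_le {n : ℕ} {A : Matrix (Fin n) (Fin n) ℝ} (hA : A.IsHermitian)
    (x : Fin n → ℝ) : minEigenvalue A * ∑ j, x j ^ 2 ≤ x ⬝ᵥ (A *ᵥ x) := by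
  have hpsd : (A - algebraMap ℝ _ (minEigenvalue A)).PosSemidef := by
    rw [posSemidef_iff_isHermitian_and_spectrum_nonneg]
    refine ⟨hA.sub ?_, fun t ht => ?_⟩
    · rw [algebraMap_eq_diagonal]
      exact isHermitian_diagonal _
    · have h1 : t + minEigenvalue A ∈ spectrum ℝ A := by
        have h := spectrum.add_mem_add_iff (s := minEigenvalue A).2 ht
        rwa [add_sub_cancel] at h
      have h2 : minEigenvalue A ≤ t + minEigenvalue A :=
        csInf_le A.finite_real_spectrum.bddBelow h1
      simpa using h2
  have h := hpsd.dotProduct_mulVec_nonneg x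
  rw [sub_mulVec, dotProduct_sub, Algebra.algebraMap_eq_smul_one, smul_mulVec, one_mulVec, dotProduct_smul] at h
  simp only [star_trivial, smul_eq_mul] at h
  have h3 : x ⬝ᵥ x = ∑ j, x j ^ 2 := by simp [dotProduct, pow_two]
  rw [h3] at h
  linarith

/-- The shift moves a nonnegative spectrum up by `r`. Positive size matters: for an empty spectrum
the infimum is `0` by convention. -/
lemma minEigenvalue_add_smul_one_pos {n : ℕ} [NeZero n] {A : Matrix (Fin n) (Fin n) ℝ}
    (hA : A.PosSemidef) {r : ℝ} (hr : 0 < r) :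
    0 < minEigenvalue (A + r • (1 : Matrix (Fin n) (Fin n) ℝ)) := by
  have hH : (A + r • (1 : Matrix (Fin n) (Fin n) ℝ)).IsHermitian :=
    hA.1.add (by rw [IsHermitian, conjTranspose_smul, conjTranspose_one, star_trivial])
  refine hr.trans_le (le_csInf ?_ fun t ht => ?_)
  · rw [hH.spectrum_real_eq_range_eigenvalues]
    exact Set.range_nonempty _
  · have h := (posSemidef_iff_isHermitian_and_spectrum_nonneg.1 hA).2
    have h1 : t - r ∈ spectrum ℝ A := by
      rw [← spectrum.add_mem_add_iff (s := r)]
      rw [← Algebra.algebraMap_eq_smul_one, add_comm] at ht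
      simpa using ht
    simpa using h h1

/-- With `e` an orthonormal basis of the range of `P`, this is Cauchy–Schwarz in the coordinates of
`P x`. It is what makes the rank, rather than `K`, enter the bound. -/
lemma exists_orthonormal_rank {K n : ℕ} (P : Matrix (Fin K) (Fin n) ℝ) :
    ∃ e : Fin P.rank → EuclideanSpace ℝ (Fin K), Orthonormal ℝ e ∧
      ∀ (x : Fin n → ℝ) (V : Fin K → ℝ), (∑ k, V k * (P *ᵥ x) k) ^ 2 ≤
        (∑ i, (∑ k, e i k * V k) ^ 2) * ∑ k, (P *ᵥ x) k ^ 2 := by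
  set S := LinearMap.range (toEuclideanLin P) with hS
  have hr : Module.finrank ℝ S = P.rank := by
    rw [hS, toEuclideanLin_eq_toLin_orthonormal]
    exact (rank_eq_finrank_range_toLin P _ _).symm
  let f : OrthonormalBasis (Fin P.rank) ℝ S := (stdOrthonormalBasis ℝ S).reindex (finCongr hr)
  refine ⟨fun i => (f i : EuclideanSpace ℝ (Fin K)),
    f.orthonormal.comp_linearIsometry S.subtypeₗᵢ, fun x V => ?_⟩
  let s : S := ⟨WithLp.toLp 2 (P *ᵥ x), ⟨WithLp.toLp 2 x, rfl⟩⟩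
  have hinner : ∀ a b : EuclideanSpace ℝ (Fin K), inner ℝ a b = ∑ k, a k * b k := fun a b => by
    simp [PiLp.inner_apply, mul_comm]
  have hsum : ∀ k, (P *ᵥ x) k = ∑ i, inner ℝ (f i) s * (f i : EuclideanSpace ℝ (Fin K)) k := by
    intro k
    have h := congrArg (fun z : S => (z : EuclideanSpace ℝ (Fin K)) k) (f.sum_repr' s)
    simp only [Submodule.coe_sum, Submodule.coe_smul, WithLp.ofLp_sum, Finset.sum_apply,
      PiLp.smul_apply, smul_eq_mul] at h
    exact h.symm
  have hsq : ∑ i, inner ℝ (f i) s ^ 2 = ∑ k, (P *ᵥ x) k ^ 2 := by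
    have h := f.sum_sq_norm_inner_right s
    simp only [Real.norm_eq_abs, sq_abs] at h
    rw [h, ← real_inner_self_eq_norm_sq, Submodule.coe_inner, hinner]
    exact Finset.sum_congr rfl fun k _ => (pow_two _).symm
  have hV : ∑ k, V k * (P *ᵥ x) k =
      ∑ i, (∑ k, (f i : EuclideanSpace ℝ (Fin K)) k * V k) * inner ℝ (f i) s := by
    simp_rw [hsum, Finset.mul_sum, Finset.sum_mul]
    rw [Finset.sum_comm]
    exact Finset.sum_congr rfl fun _ _ => Finset.sum_congr rfl fun _ _ => by ring
  rw [hV, ← hsq]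
  exact Finset.sum_mul_sq_le_sq_mul_sq _ _ _

lemma rank_smul_transpose_mul_self {K n : ℕ} (hK : 0 < K) (P : Matrix (Fin K) (Fin n) ℝ) :
    ((1 / (K : ℝ)) • (Pᵀ * P)).rank = P.rank := by
  rw [rank_smul_of_mem_nonZeroDivisors, rank_transpose_mul_self]
  exact mem_nonZeroDivisors_of_ne_zero (by positivity)

/-- The basic inequality `ω / 2 ‖P x‖² ≤ ⟨V, P x⟩`, with control of the projection of `V` to the
range of `P`, bounds `x`. -/
lemma norm_le_errorBound {K n : ℕ} [NeZero n] (hK : 0 < K) {P : Matrix (Fin K) (Fin n) ℝ}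
    {S : Matrix (Fin n) (Fin n) ℝ} (hS : S = (1 / (K : ℝ)) • (Pᵀ * P))
    {c r δ q : ℝ} (hr : 0 < r) (hδ : δ ∈ Set.Ioo (0 : ℝ) 1)
    {x : Fin n → ℝ} {V : Fin K → ℝ} (hx : ∀ j, |x j| ≤ c)
    (hV : 1 / (2 + 2 * Real.exp (2 * c)) / 2 * ∑ k, (P *ᵥ x) k ^ 2 ≤ ∑ k, V k * (P *ᵥ x) k)
    (hq : (∑ k, V k * (P *ᵥ x) k) ^ 2 ≤ q * ∑ k, (P *ᵥ x) k ^ 2)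
    (hqS : q ≤ S.rank - Real.log δ) :
    √(∑ j, x j ^ 2) ≤ errorBound K c r δ S := by
  have hK' : (0 : ℝ) < K := by exact_mod_cast hK
  set ω := 1 / (2 + 2 * Real.exp (2 * c)) with hω
  have hω0 : 0 < ω := by positivity
  set T := ∑ k, (P *ᵥ x) k ^ 2 with hT
  have hT0 : 0 ≤ T := Finset.sum_nonneg fun _ _ => sq_nonneg _
  have hlog : Real.log δ < 0 := Real.log_neg hδ.1 hδ.2
  set D := deviation K c δ S with hD
  have hD1 : (S.rank - Real.log δ) / (ω ^ 2 * K) ≤ D := by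
    rw [hD, deviation, ← hω]
    refine div_le_div_of_nonneg_right ?_ (by positivity)
    have := Real.sqrt_nonneg (-(S.rank : ℝ) * Real.log δ)
    linarith
  have hD0 : 0 ≤ D := le_trans (div_nonneg (by
    have : (0 : ℝ) ≤ S.rank := Nat.cast_nonneg _
    linarith) (by positivity)) hD1
  have hTle : T / K ≤ 4 * D := by
    have h1 : (ω / 2 * T) ^ 2 ≤ q * T := (pow_le_pow_left₀ (by positivity) hV 2).trans hq
    rcases hT0.eq_or_lt with h0 | h0
    -- The case `P x = 0` is separate because a factor `T` is cancelled below.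
    · rw [← h0]; simp; exact hD0
    · have h2 : ω ^ 2 / 4 * T ≤ S.rank - Real.log δ := by
        refine le_trans (le_of_mul_le_mul_right ?_ h0) hqS
        linarith
      have h3 : T / K = 4 * (ω ^ 2 / 4 * T / (ω ^ 2 * K)) := by field_simp
      rw [h3]
      refine mul_le_mul_of_nonneg_left (le_trans ?_ hD1) (by norm_num)
      gcongr
  have hpsd : S.PosSemidef := by
    rw [hS, ← conjTranspose_eq_transpose_of_trivial]
    exact (posSemidef_conjTranspose_mul_self P).smul (by positivity)
  have hl := minEigenvalue_add_smul_one_pos hpsd hr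
  have hH : (S + r • (1 : Matrix (Fin n) (Fin n) ℝ)).IsHermitian :=
    hpsd.1.add (by rw [IsHermitian, conjTranspose_smul, conjTranspose_one, star_trivial])
  have hquad := minEigenvalue_mul_le hH x
  have hxx : x ⬝ᵥ ((S + r • (1 : Matrix (Fin n) (Fin n) ℝ)) *ᵥ x) = T / K + r * ∑ j, x j ^ 2 := by
    rw [add_mulVec, dotProduct_add, smul_mulVec, one_mulVec, dotProduct_smul, hS, smul_mulVec,
      dotProduct_smul, ← mulVec_mulVec, dotProduct_mulVec, vecMul_transpose]
    simp [dotProduct, ← pow_two, hT]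
    ring
  have hxn : ∑ j, x j ^ 2 ≤ (c * √n) ^ 2 := by
    rw [mul_pow, Real.sq_sqrt (Nat.cast_nonneg n)]
    calc ∑ j, x j ^ 2 ≤ ∑ _j : Fin n, c ^ 2 :=
          Finset.sum_le_sum fun j _ => sq_le_sq.2 ((hx j).trans (le_abs_self c))
      _ = c ^ 2 * n := by simp [mul_comm]
  rw [errorBound, le_div_iff₀ (Real.sqrt_pos.2 hl), ← Real.sqrt_mul (by positivity)]
  refine Real.sqrt_le_iff.2 ⟨by positivity, ?_⟩
  rw [← hD]
  set B := r * (c * √n) ^ 2 with hB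
  have hB0 : 0 ≤ B := by positivity
  have h1 : (∑ j, x j ^ 2) * minEigenvalue (S + r • (1 : Matrix (Fin n) (Fin n) ℝ)) ≤
      4 * D + B := by
    have := mul_le_mul_of_nonneg_left hxn hr.le
    linarith
  refine h1.trans ?_
  have h2 : √D ≤ √(D + B) := Real.sqrt_le_sqrt (by linarith)
  have h3 := Real.sq_sqrt hD0
  have h4 := Real.sq_sqrt (add_nonneg hD0 hB0)
  -- Since `√D √(D + B) ≥ D`, the square of `√D + √(D + B)` is at least `4 D + B`.
  nlinarith [Real.sqrt_nonneg D]

/-! ### Expectations under finitely supported lotteries. -/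

section Lotteries

variable {Ω : Type*} [MeasurableSpace Ω] {μ : Measure Ω} {b : ℝ} {X : Ω → ℝ}

lemma IsLottery.ae_mem_lotterySupport (hX : IsLottery μ b X) :
    ∀ᵐ w ∂μ, X w ∈ lotterySupport μ X := by
  obtain ⟨F, hF⟩ := hX.finite_support
  have h : ∀ᵐ w ∂μ, ∀ x ∈ F, X w = x → x ∈ lotterySupport μ X := by
    refine (ae_ball_iff F.countable_toSet).2 fun x _ => ?_
    by_cases hx : x ∈ lotterySupport μ X
    · exact ae_of_all _ fun _ _ => hx
    · have h0 : μ {w | X w = x} = 0 := by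
        simpa [lotterySupport] using hx
      filter_upwards [measure_eq_zero_iff_ae_notMem.1 h0] with w hw hwx
      exact absurd hwx hw
  filter_upwards [h, hF] with w hw hwF
  exact hw _ hwF rfl

lemma IsLottery.lotterySupport_subset (hX : IsLottery μ b X) :
    lotterySupport μ X ⊆ Set.Icc 0 b := by
  intro x hx
  obtain ⟨w, hw⟩ := nonempty_of_measure_ne_zero (ne_of_gt hx)
  exact hw ▸ hX.mem_Icc w

lemma IsLottery.integral_comp [IsFiniteMeasure μ] (hX : IsLottery μ b X) {m : ℕ} {y : Fin m → ℝ}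
    (hy : Function.Injective y) (hs : lotterySupport μ X ⊆ Set.range y) (u : ℝ → ℝ) :
    ∫ w, u (X w) ∂μ = ∑ j, μ.real {w | X w = y j} * u (y j) := by
  have hm : ∀ j, MeasurableSet {w | X w = y j} := fun j =>
    hX.measurable (measurableSet_singleton (y j))
  have h : (fun w => u (X w)) =ᵐ[μ]
      fun w => ∑ j, {w | X w = y j}.indicator (fun _ => u (y j)) w := by
    filter_upwards [hX.ae_mem_lotterySupport] with w hw
    obtain ⟨j, hj⟩ := hs hw
    rw [Finset.sum_eq_single j]
    · rw [Set.indicator_of_mem (by exact hj.symm), hj]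
    · intro i _ hi
      refine Set.indicator_of_notMem (fun hw' => hi (hy ?_)) _
      exact (show X w = y i from hw').symm.trans hj.symm
    · simp
  rw [integral_congr_ae h, integral_finsetSum _ fun j _ =>
    (integrable_const _).indicator (hm j)]
  exact Finset.sum_congr rfl fun j _ => by rw [integral_indicator_const _ (hm j), smul_eq_mul]

lemma IsLottery.sum_measureReal_mul_mem_Icc [IsProbabilityMeasure μ] (hX : IsLottery μ b X)
    {m : ℕ} {y : Fin m → ℝ} (hy : Function.Injective y)
    (hs : lotterySupport μ X ⊆ Set.range y) {a : Fin m → ℝ} {c : ℝ}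
    (ha : ∀ j, a j ∈ Set.Icc 0 c) :
    ∑ j, μ.real {w | X w = y j} * a j ∈ Set.Icc 0 c := by
  -- The constant function `1` shows that the masses at the `y j` sum to `1`.
  have h1 := hX.integral_comp hy hs fun _ => 1
  simp only [integral_const, probReal_univ, smul_eq_mul, mul_one] at h1
  refine ⟨Finset.sum_nonneg fun j _ => mul_nonneg measureReal_nonneg (ha j).1, ?_⟩
  calc _ ≤ ∑ j, μ.real {w | X w = y j} * c :=
        Finset.sum_le_sum fun j _ => mul_le_mul_of_nonneg_left (ha j).2 measureReal_nonneg
    _ = c := by rw [← Finset.sum_mul, ← h1, one_mul]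

end Lotteries

/-! ### Breakpoints and mean differences. -/

section Breakpoints

variable {Ω : Type*} [MeasurableSpace Ω] {μ : Measure Ω} {b : ℝ} {K : ℕ} {W Y : Fin K → Ω → ℝ}

lemma breakpoints_subset_Icc (hb : 0 ≤ b) (hW : ∀ k, IsLottery μ b (W k))
    (hY : ∀ k, IsLottery μ b (Y k)) : breakpoints μ b W Y ⊆ Set.Icc 0 b := by
  rintro x (((hx | hx) | hx) | hx)
  · rw [Set.mem_singleton_iff.1 hx]; exact ⟨le_rfl, hb⟩
  · obtain ⟨k, hk⟩ := Set.mem_iUnion.1 hx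
    exact (hW k).lotterySupport_subset hk
  · obtain ⟨k, hk⟩ := Set.mem_iUnion.1 hx
    exact (hY k).lotterySupport_subset hk
  · rw [Set.mem_singleton_iff.1 hx]; exact ⟨hb, le_rfl⟩

lemma lotterySupport_subset_breakpoints_left (k : Fin K) :
    lotterySupport μ (W k) ⊆ breakpoints μ b W Y :=
  fun _ hx => Or.inl (Or.inl (Or.inr (Set.mem_iUnion.2 ⟨k, hx⟩)))

lemma lotterySupport_subset_breakpoints_right (k : Fin K) :
    lotterySupport μ (Y k) ⊆ breakpoints μ b W Y :=
  fun _ hx => Or.inl (Or.inr (Set.mem_iUnion.2 ⟨k, hx⟩))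

variable {n : ℕ} {y : Fin (n + 1) → ℝ}

lemma apply_zero_of_range_eq_breakpoints (hb : 0 ≤ b) (hW : ∀ k, IsLottery μ b (W k))
    (hY : ∀ k, IsLottery μ b (Y k)) (hy : StrictMono y)
    (hyS : Set.range y = breakpoints μ b W Y) : y 0 = 0 := by
  have h0 : (0 : ℝ) ∈ Set.range y := hyS ▸ Or.inl (Or.inl (Or.inl rfl))
  obtain ⟨j, hj⟩ := h0
  refine le_antisymm (hj ▸ hy.monotone (Fin.zero_le j)) ?_
  exact (breakpoints_subset_Icc hb hW hY (hyS ▸ Set.mem_range_self 0)).1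

lemma apply_last_of_range_eq_breakpoints (hb : 0 ≤ b) (hW : ∀ k, IsLottery μ b (W k))
    (hY : ∀ k, IsLottery μ b (Y k)) (hy : StrictMono y)
    (hyS : Set.range y = breakpoints μ b W Y) : y (Fin.last n) = b := by
  have h0 : b ∈ Set.range y := hyS ▸ Or.inr rfl
  obtain ⟨j, hj⟩ := h0
  refine le_antisymm ?_ (hj ▸ hy.monotone (Fin.le_last j))
  exact (breakpoints_subset_Icc hb hW hY (hyS ▸ Set.mem_range_self _)).2

/-- The mean difference of `a` under the `k`-th pair of lotteries is a number in `[-c, c]`. -/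
lemma sum_massDiff_mul_mem_Icc [IsProbabilityMeasure μ] (hW : ∀ k, IsLottery μ b (W k))
    (hY : ∀ k, IsLottery μ b (Y k)) (hy : StrictMono y)
    (hyS : Set.range y = breakpoints μ b W Y) {a : Fin (n + 1) → ℝ} {c : ℝ}
    (ha : ∀ j, a j ∈ Set.Icc 0 c) (k : Fin K) :
    ∑ j, massDiff μ y W Y k j * a j ∈ Set.Icc (-c) c := by
  have h1 := (hW k).sum_measureReal_mul_mem_Icc hy.injective
    (hyS ▸ lotterySupport_subset_breakpoints_left k) ha
  have h2 := (hY k).sum_measureReal_mul_mem_Icc hy.injective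
    (hyS ▸ lotterySupport_subset_breakpoints_right k) ha
  simp only [massDiff, sub_mul, Finset.sum_sub_distrib]
  exact ⟨by linarith [h1.1, h2.2], by linarith [h1.2, h2.1]⟩

lemma integral_sub_integral_eq_sum [IsProbabilityMeasure μ] (hW : ∀ k, IsLottery μ b (W k))
    (hY : ∀ k, IsLottery μ b (Y k)) (hy : StrictMono y)
    (hyS : Set.range y = breakpoints μ b W Y) (u : ℝ → ℝ) (s : ℝ) (k : Fin K) :
    ((∫ v, u (W k v) ∂μ) - ∫ v, u (Y k v) ∂μ) / s =
      ∑ j, massDiff μ y W Y k j * (u (y j) / s) := by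
  rw [(hW k).integral_comp hy.injective (hyS ▸ lotterySupport_subset_breakpoints_left k),
    (hY k).integral_comp hy.injective (hyS ▸ lotterySupport_subset_breakpoints_right k),
    ← Finset.sum_sub_distrib, Finset.sum_div]
  exact Finset.sum_congr rfl fun j _ => by rw [massDiff]; ring

end Breakpoints

/-! ### Feasible points and the likelihood. -/

section ConvexProgram

variable {n : ℕ} {L c : ℝ} {y : Fin (n + 1) → ℝ}

lemma IsUtility.isFeasible {b : ℝ} {u : ℝ → ℝ} (hu : IsUtility b L u) {s : ℝ} (hc : 0 < c)
    (hs : 1 / c ≤ s) (hy : StrictMono y) (hmem : ∀ j, y j ∈ Set.Icc 0 b) (h0 : y 0 = 0)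
    (hl : y (Fin.last n) = b) :
    IsFeasible L c y (fun j => u (y j) / s)
      (fun j => (u (y j.succ) / s - u (y j.castSucc) / s) / (y j.succ - y j.castSucc)) (1 / s) := by
  have hs0 : 0 < s := (by positivity : 0 < 1 / c).trans_le hs
  have hlt : ∀ j : Fin n, y j.castSucc < y j.succ := fun j => hy Fin.castSucc_lt_succ
  have hsl : ∀ j : Fin n, (u (y j.succ) / s - u (y j.castSucc) / s) / (y j.succ - y j.castSucc) =
      (u (y j.succ) - u (y j.castSucc)) / (y j.succ - y j.castSucc) / s := fun j => by ring
  refine ⟨fun j => rfl, fun i j hij => ?_, fun j _ => ?_, fun j _ => ?_, ?_, ?_, ?_, ?_⟩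
  · have he : i.succ = j.castSucc := Fin.ext (by simp [hij])
    simp only [hsl]
    refine div_le_div_of_nonneg_right ?_ hs0.le
    have := hu.concave.slope_anti_adjacent (hmem i.castSucc) (hmem j.succ) (y := y i.succ)
      (hlt i) (he ▸ hlt j)
    rwa [he] at this ⊢
  · simp only [hsl]
    rw [mul_one_div]
    refine div_le_div_of_nonneg_right ?_ hs0.le
    have hp := sub_pos.2 (hlt j)
    rw [div_le_iff₀ hp]
    have := hu.lipschitz _ (hmem j.succ) _ (hmem j.castSucc)
    rw [abs_of_pos hp] at this
    exact (le_abs_self _).trans this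
  · simp only [hsl]
    refine div_nonneg (div_nonneg (sub_nonneg.2 ?_) (sub_pos.2 (hlt j)).le) hs0.le
    exact hu.monotone (hmem _) (hmem _) (hlt j).le
  · simp [h0, hu.map_zero]
  · simp [hl, hu.map_right]
  · positivity
  · exact (one_div_le hc hs0).1 hs

/-- The slopes decrease to a nonnegative last slope, so all are nonnegative and `a` increases from
`0` to `γ`. -/
lemma IsFeasible.mem_Icc {a : Fin (n + 1) → ℝ} {β : Fin n → ℝ} {γ : ℝ}
    (h : IsFeasible L c y a β γ) (hy : StrictMono y) (j : Fin (n + 1)) : a j ∈ Set.Icc 0 γ := by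
  have hβ : ∀ m : ℕ, ∀ j : Fin n, j.val + 1 + m = n → 0 ≤ β j := by
    intro m
    induction m with
    | zero => exact fun j hj => h.slope_last j hj
    | succ m ih =>
      intro j hj
      exact (ih ⟨j.val + 1, by omega⟩ (by simp only; omega)).trans (h.slope_anti j _ rfl)
  have hmono : Monotone a := by
    rw [Fin.monotone_iff_le_succ]
    intro i
    have h1 := hβ (n - (i.val + 1)) i (by omega)
    have hp := sub_pos.2 (hy (Fin.castSucc_lt_succ (i := i)))
    rw [h.slope i, le_div_iff₀ hp] at h1
    linarith
  exact ⟨h.left ▸ hmono (Fin.zero_le j), h.right ▸ hmono (Fin.le_last j)⟩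

/-- If `γ = 0`, the entries of `a` are squeezed to `0`, in agreement with the convention for `σ̂ =
+∞`. -/
lemma IsFeasible.scaledEstimate_eq {a : Fin (n + 1) → ℝ} {β : Fin n → ℝ} {γ : ℝ}
    (h : IsFeasible L c y a β γ) (hy : StrictMono y) : scaledEstimate a γ = a := by
  unfold scaledEstimate
  split_ifs with hγ
  · funext j
    field_simp
  · funext j
    have := h.mem_Icc hy j
    have h0 := h.scale.1
    simp only [Pi.zero_apply]
    linarith [this.1, this.2]

lemma objective_eq {K : ℕ} (p : Fin K → Fin (n + 1) → ℝ) (Z : Fin K → ℝ) (a : Fin (n + 1) → ℝ) :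
    objective p Z a = -∑ k, Real.log (1 + Real.exp (-(Z k * ∑ j, p k j * a j))) := by
  unfold objective
  congr 1
  refine Finset.sum_congr rfl fun k _ => ?_
  rw [Finset.mul_sum, ← Finset.sum_neg_distrib]
  congr 4
  funext j
  ring

lemma logLik_eq {Ω : Type*} [MeasurableSpace Ω] {μ : Measure Ω} [IsProbabilityMeasure μ] {b : ℝ}
    {K : ℕ} {W Y : Fin K → Ω → ℝ} (hW : ∀ k, IsLottery μ b (W k))
    (hY : ∀ k, IsLottery μ b (Y k)) (hy : StrictMono y)
    (hyS : Set.range y = breakpoints μ b W Y) (Z : Fin K → ℝ) (u : ℝ → ℝ) (s : ℝ) :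
    logLik μ W Y Z u s = objective (massDiff μ y W Y) Z fun j => u (y j) / s := by
  rw [objective_eq, logLik, ← Finset.sum_neg_distrib]
  refine Finset.sum_congr rfl fun k _ => ?_
  rw [one_div, Real.log_inv, ← integral_sub_integral_eq_sum hW hY hy hyS]
  ring_nf

end ConvexProgram

/-! ### Residuals and the basic inequality. -/

/-- The score of a response: the indicator of a positive answer minus its probability. -/
noncomputable def residual (A B s : ℝ) (e : Fin 2 → ℝ) : ℝ :=
  open Classical in
  (if B + e 1 ≤ A + e 0 then 1 else 0) - 1 / (1 + Real.exp (-((A - B) / s)))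

lemma measurable_residual (A B s : ℝ) : Measurable (residual A B s) := by
  unfold residual
  refine Measurable.sub_const (Measurable.ite ?_ measurable_const measurable_const) _
  exact measurableSet_le (by fun_prop) (by fun_prop)

lemma residual_mem_Icc (A B s : ℝ) (e : Fin 2 → ℝ) :
    residual A B s e ∈ Set.Icc (0 - 1 / (1 + Real.exp (-((A - B) / s))))
      (1 - 1 / (1 + Real.exp (-((A - B) / s)))) := by
  unfold residual
  split_ifs
  · exact ⟨by linarith, le_rfl⟩
  · exact ⟨le_rfl, by linarith⟩

section Stochastic

variable {Ω : Type*} [MeasurableSpace Ω] {μ : Measure Ω} [IsProbabilityMeasure μ]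

lemma integral_residual {s : ℝ} (hs : 0 < s) {ε : Fin 2 → Ω → ℝ} (hεm : ∀ i, Measurable (ε i))
    (hε : ∀ i, μ.map (ε i) = gumbelMeasure s) (hind : IndepFun (ε 0) (ε 1) μ) (A B : ℝ) :
    ∫ w, residual A B s (fun i => ε i w) ∂μ = 0 := by
  have hp : IsProbabilityMeasure (gumbelMeasure s) :=
    hε 0 ▸ Measure.isProbabilityMeasure_map (hεm 0).aemeasurable
  have hm : MeasurableSet {w | B + ε 1 w ≤ A + ε 0 w} := measurableSet_le
    ((hεm 1).const_add _) ((hεm 0).const_add _)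
  have hset : {w | B + ε 1 w ≤ A + ε 0 w} =
      (fun w => (ε 0 w, ε 1 w)) ⁻¹' {p : ℝ × ℝ | p.2 ≤ p.1 + (A - B)} := by
    ext w
    simp only [Set.mem_ofPred_eq, Set.mem_preimage]
    constructor <;> intro h <;> linarith
  have hprob : μ {w | B + ε 1 w ≤ A + ε 0 w} =
      ENNReal.ofReal (1 / (1 + Real.exp (-((A - B) / s)))) := by
    rw [hset, ← Measure.map_apply ((hεm 0).prodMk (hεm 1))
      (measurableSet_le (by fun_prop) (by fun_prop)),
      (indepFun_iff_map_prod_eq_prod_map_map (hεm 0).aemeasurable (hεm 1).aemeasurable).1 hind,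
      hε, hε, gumbelMeasure_prod_le hs]
  have hfun : (fun w => residual A B s (fun i => ε i w)) = fun w =>
      {w | B + ε 1 w ≤ A + ε 0 w}.indicator (fun _ => (1 : ℝ)) w -
        1 / (1 + Real.exp (-((A - B) / s))) := by
    funext w
    simp only [residual, Set.indicator_apply, Set.mem_ofPred_eq]
  rw [hfun, integral_sub ((integrable_const _).indicator hm) (integrable_const _),
    integral_indicator_const _ hm, Measure.real, hprob, ENNReal.toReal_ofReal (by positivity)]
  simp

/-- Hoeffding's lemma: a centred variable in an interval of length one has variance factor `(1/2)²`.
-/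
lemma hasSubgaussianMGF_residual {s : ℝ} (hs : 0 < s) {ε : Fin 2 → Ω → ℝ}
    (hεm : ∀ i, Measurable (ε i)) (hε : ∀ i, μ.map (ε i) = gumbelMeasure s)
    (hind : IndepFun (ε 0) (ε 1) μ) (A B : ℝ) :
    HasSubgaussianMGF (fun w => residual A B s (fun i => ε i w)) (1 / 4) μ := by
  have h := hasSubgaussianMGF_of_mem_Icc_of_integral_eq_zero
    ((measurable_residual A B s).comp (measurable_pi_lambda _ hεm)).aemeasurable
    (ae_of_all μ fun w => residual_mem_Icc A B s fun i => ε i w)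
    (integral_residual hs hεm hε hind A B)
  refine (?_ : ((1 : NNReal) / 4) = _) ▸ h
  rw [sub_sub_sub_cancel_right, sub_zero, nnnorm_one]
  norm_num

end Stochastic

/-- The left side is minus the derivative of the loss at `t`, so the linear term of the expansion at
`θ` is governed by the centred residual. -/
lemma choice_mul_eq_residual {Ω : Type*} [MeasurableSpace Ω] {μ : Measure Ω} {K : ℕ}
    {u : ℝ → ℝ} {W Y : Fin K → Ω → ℝ}
    {ε : Fin K → Fin 2 → Ω → ℝ} {s : ℝ} (w : Ω) (k : Fin K) (t : ℝ)
    (ht : ((∫ v, u (W k v) ∂μ) - ∫ v, u (Y k v) ∂μ) / s = t) :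
    (choice μ u W Y ε w k = 1 ∨ choice μ u W Y ε w k = -1) ∧
    choice μ u W Y ε w k * (1 / (1 + Real.exp (choice μ u W Y ε w k * t))) =
      residual (∫ v, u (W k v) ∂μ) (∫ v, u (Y k v) ∂μ) s (fun i => ε k i w) := by
  unfold choice residual
  rw [ht]
  split_ifs
  · refine ⟨Or.inl rfl, ?_⟩
    rw [one_mul, one_mul, Real.exp_neg]
    field_simp
    ring
  · refine ⟨Or.inr rfl, ?_⟩
    rw [neg_one_mul]
    ring_nf

lemma errorsLE_of_sqrt_sum_le {n : ℕ} {a θ : Fin (n + 1) → ℝ} {B : ℝ} (h0 : a 0 = θ 0)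
    (h : √(∑ j : Fin n, (a j.succ - θ j.succ) ^ 2) ≤ B) : ErrorsLE a θ B := by
  refine ⟨(pi_norm_le_iff_of_nonneg (norm_nonneg _)).2 fun j =>
    PiLp.norm_apply_le (WithLp.toLp 2 (a - θ)) j, ?_⟩
  rw [EuclideanSpace.norm_eq, Fin.sum_univ_succ]
  simpa [h0] using h

/-- The logistic losses at `t` and `t'` compared, for the response `z = ± 1`. -/
lemma logistic_loss_ge {c t t' z : ℝ} (hz : z = 1 ∨ z = -1) (ht : t ∈ Set.Icc (-c) c)
    (ht' : t' ∈ Set.Icc (-c) c) :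
    Real.log (1 + Real.exp (-(z * t))) - z * (1 / (1 + Real.exp (z * t))) * (t' - t) +
        1 / (2 + 2 * Real.exp (2 * c)) / 2 * (t' - t) ^ 2 ≤
      Real.log (1 + Real.exp (-(z * t'))) := by
  have hz2 : z ^ 2 = 1 := by rcases hz with rfl | rfl <;> norm_num
  have hmem : ∀ x ∈ Set.Icc (-c) c, z * x ∈ Set.Icc (-c) c := by
    rintro x ⟨h1, h2⟩
    rcases hz with rfl | rfl
    · exact ⟨by linarith, by linarith⟩
    · exact ⟨by linarith, by linarith⟩
  have h := log_one_add_exp_neg_ge (hmem t ht) (hmem t' ht')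
  rw [← mul_sub, mul_pow, hz2, one_mul] at h
  linarith

lemma errorsLE_of_loss_le {n K : ℕ} [NeZero n] (hK : 0 < K) {p : Fin K → Fin (n + 1) → ℝ}
    {S : Matrix (Fin n) (Fin n) ℝ} {P : Matrix (Fin K) (Fin n) ℝ}
    (hP : P = Matrix.of fun k j => p k j.succ) (hS : S = (1 / (K : ℝ)) • (Pᵀ * P))
    {c r δ q : ℝ} (hr : 0 < r) (hδ : δ ∈ Set.Ioo (0 : ℝ) 1) {Z : Fin K → ℝ}
    (hZ : ∀ k, Z k = 1 ∨ Z k = -1) {a θ : Fin (n + 1) → ℝ}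
    (ha : ∀ j, a j ∈ Set.Icc 0 c) (hθ : ∀ j, θ j ∈ Set.Icc 0 c) (ha0 : a 0 = 0) (hθ0 : θ 0 = 0)
    (hpa : ∀ k, ∑ j, p k j * a j ∈ Set.Icc (-c) c) (hpθ : ∀ k, ∑ j, p k j * θ j ∈ Set.Icc (-c) c)
    (hobj : objective p Z θ ≤ objective p Z a)
    (hq : ∀ x : Fin n → ℝ, (∑ k, Z k * (1 / (1 + Real.exp (Z k * ∑ j, p k j * θ j))) *
      (P *ᵥ x) k) ^ 2 ≤ q * ∑ k, (P *ᵥ x) k ^ 2)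
    (hqS : q ≤ S.rank - Real.log δ) :
    ErrorsLE a θ (errorBound K c r δ S) := by
  refine errorsLE_of_sqrt_sum_le (ha0.trans hθ0.symm) ?_
  have hx : ∀ k, (P *ᵥ fun j => a j.succ - θ j.succ) k =
      ∑ j, p k j * a j - ∑ j, p k j * θ j := fun k => by
    rw [Fin.sum_univ_succ, Fin.sum_univ_succ (f := fun j => p k j * θ j), ha0, hθ0]
    simp only [mulVec, dotProduct, hP, Matrix.of_apply, mul_sub, Finset.sum_sub_distrib]
    ring
  refine norm_le_errorBound hK hS hr hδ (fun j => ?_) ?_ (hq _) hqS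
  · have h1 := ha j.succ
    have h2 := hθ j.succ
    rw [abs_le]
    exact ⟨by linarith [h1.1, h2.2], by linarith [h1.2, h2.1]⟩
  · rw [objective_eq, objective_eq, neg_le_neg_iff] at hobj
    have h := (Finset.sum_le_sum fun k (_ : k ∈ Finset.univ) =>
      logistic_loss_ge (hZ k) (hpθ k) (hpa k)).trans hobj
    simp only [hx]
    rw [Finset.sum_add_distrib, Finset.sum_sub_distrib, ← Finset.mul_sum] at h
    linarith

end VNM

/-- With probability at least `1 - δ`, the error bounds hold simultaneously for the estimate
of every optimal solution of the convex program and for every maximizer `(u, s)` of the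
log-likelihood. -/
theorem mainTheorem4
    {Ω : Type*} [MeasurableSpace Ω] (μ : Measure Ω) [IsProbabilityMeasure μ]
    -- the range of outcomes, the Lipschitz modulus and the bound on `1 / σ`
    (b L c : ℝ) (hb : 0 ≤ b) (hL : 0 < L) (hc : 0 < c)
    -- the true utility function and the true scale of the response error
    (uStar : ℝ → ℝ) (hu : VNM.IsUtility b L uStar) (σStar : ℝ) (hσ : 1 / c ≤ σStar)
    -- the pairs of lotteries
    (K : ℕ) (hK : 0 < K) (W Y : Fin K → Ω → ℝ)
    (hW : ∀ k, VNM.IsLottery μ b (W k)) (hY : ∀ k, VNM.IsLottery μ b (Y k))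
    -- the increasing enumeration of the breakpoints, `N = n + 1`
    (n : ℕ) (y : Fin (n + 1) → ℝ) (hy : StrictMono y)
    (hyS : Set.range y = VNM.breakpoints μ b W Y)
    -- the i.i.d. Gumbel response errors
    (ε : Fin K → Fin 2 → Ω → ℝ) (hεm : ∀ k i, Measurable (ε k i))
    (hε : ∀ k i, μ.map (ε k i) = VNM.gumbelMeasure σStar)
    (hind : iIndepFun (fun ki : Fin K × Fin 2 => ε ki.1 ki.2) μ)
    (r : ℝ) (hr : 0 < r) (δ : ℝ) (hδ : δ ∈ Set.Ioo (0 : ℝ) 1) :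
    1 - δ ≤ μ.real {w |
      (∀ a β γ,
        VNM.IsOptimal L c y (VNM.massDiff μ y W Y) (VNM.choice μ uStar W Y ε w) a β γ →
        VNM.ErrorsLE (VNM.scaledEstimate a γ) (fun j => uStar (y j) / σStar)
          (VNM.errorBound K c r δ (VNM.infoMatrix μ y W Y))) ∧
      (∀ u s,
        VNM.IsMLE μ b L c W Y (VNM.choice μ uStar W Y ε w) u s →
        VNM.ErrorsLE (fun j => u (y j) / s) (fun j => uStar (y j) / σStar)
          (VNM.errorBound K c r δ (VNM.infoMatrix μ y W Y)))} := by
  have hσ0 : 0 < σStar := (by positivity : 0 < 1 / c).trans_le hσ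
  have hmem : ∀ j, y j ∈ Set.Icc 0 b := fun j =>
    VNM.breakpoints_subset_Icc hb hW hY (hyS ▸ Set.mem_range_self j)
  have hy0 := VNM.apply_zero_of_range_eq_breakpoints hb hW hY hy hyS
  have hyl := VNM.apply_last_of_range_eq_breakpoints hb hW hY hy hyS
  -- A single breakpoint would force `b = 0`, contradicting `u 0 = 0` and `u b = 1`.
  have hn : NeZero n := ⟨by
    rintro rfl
    have h : uStar (y 0) = uStar (y (Fin.last 0)) := rfl
    rw [hy0, hyl, hu.map_zero, hu.map_right] at h
    exact zero_ne_one h⟩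
  have hfeas : ∀ u s, VNM.IsUtility b L u → 1 / c ≤ s → ∃ β,
      VNM.IsFeasible L c y (fun j => u (y j) / s) β (1 / s) := fun u s hu' hs =>
    ⟨_, hu'.isFeasible hc hs hy hmem hy0 hyl⟩
  have hrange : ∀ {a β γ}, VNM.IsFeasible L c y a β γ → ∀ j, a j ∈ Set.Icc 0 c := fun h j =>
    ⟨(h.mem_Icc hy j).1, (h.mem_Icc hy j).2.trans h.scale.2⟩
  obtain ⟨βStar, hθ⟩ := hfeas uStar σStar hu hσ
  obtain ⟨e, he, hproj⟩ := VNM.exists_orthonormal_rank (VNM.massDiffMatrix μ y W Y)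
  have hrank : (VNM.infoMatrix μ y W Y).rank = (VNM.massDiffMatrix μ y W Y).rank :=
    VNM.rank_smul_transpose_mul_self hK _
  have hres : ∀ k, Measurable fun w => VNM.residual (∫ v, uStar (W k v) ∂μ)
      (∫ v, uStar (Y k v) ∂μ) σStar (fun i => ε k i w) := fun k =>
    (VNM.measurable_residual _ _ _).comp (measurable_pi_lambda _ (hεm k))
  have htail := VNM.one_sub_le_measureReal_sum_sq_le hres
    ((VNM.iIndepFun_curry hεm hind).comp _ fun k => VNM.measurable_residual
      (∫ v, uStar (W k v) ∂μ) (∫ v, uStar (Y k v) ∂μ) σStar)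
    (fun k => VNM.hasSubgaussianMGF_residual hσ0 (hεm k) (hε k)
      (hind.indepFun (i := (k, 0)) (j := (k, 1)) (by simp)) _ _) he hδ.1
  -- Monotonicity of the measure suffices, so the target event need not be measurable.
  refine htail.trans (measureReal_mono fun w hw => ?_)
  -- Optimality enters only through the comparison with `θ`, so this covers both kinds of estimate.
  have hcore : ∀ {a β γ}, VNM.IsFeasible L c y a β γ →
      VNM.objective (VNM.massDiff μ y W Y) (VNM.choice μ uStar W Y ε w)
        (fun j => uStar (y j) / σStar) ≤
      VNM.objective (VNM.massDiff μ y W Y) (VNM.choice μ uStar W Y ε w) a →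
      VNM.ErrorsLE a (fun j => uStar (y j) / σStar)
        (VNM.errorBound K c r δ (VNM.infoMatrix μ y W Y)) := fun {a β γ} h hobj => by
    have hch := fun k => VNM.choice_mul_eq_residual (ε := ε) w k _
      (VNM.integral_sub_integral_eq_sum hW hY hy hyS uStar σStar k)
    refine VNM.errorsLE_of_loss_le hK rfl rfl hr hδ (fun k => (hch k).1) (hrange h) (hrange hθ)
      h.left hθ.left (VNM.sum_massDiff_mul_mem_Icc hW hY hy hyS (hrange h))
      (VNM.sum_massDiff_mul_mem_Icc hW hY hy hyS (hrange hθ)) hobj (fun x => ?_)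
      (hw.trans_eq
        (congrArg (fun m : ℕ => (m : ℝ) - Real.log δ) hrank.symm))
    simp only [(hch _).2]
    exact hproj x _
  refine ⟨fun a β γ h => ?_, fun u s h => ?_⟩
  · rw [h.1.scaledEstimate_eq hy]
    exact hcore h.1 (h.2 _ _ _ hθ)
  · obtain ⟨β, hβ⟩ := hfeas u s h.1.1 h.1.2
    refine hcore hβ ?_
    rw [← VNM.logLik_eq hW hY hy hyS, ← VNM.logLik_eq hW hY hy hyS]
    exact h.2 uStar σStar hu hσ
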